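/- Let $k \geq 1$ and let $\Lambda_1,\dots,\Lambda_k$ be (real or complex) Hilbert spaces, with metrics $d_{\Lambda_i}(a,b)=\|a-b\|$ and Borel $\sigma$-algebras. A labelled $k$-partitioned measure $2$-network is a tuple $L=\big((X_i,\mu_i)_{i=1}^k,\omega,(\iota_i)_{i=1}^k\big)$ where the $X_i$ are pairwise disjoint Polish spaces with Borel probability measures $\mu_i$; with $X=\bigsqcup_i X_i$ and $\mu=\sum_i\mu_i$, the function $\omega:X\times X\to[0,\infty)$ belongs to $L^2(\mu\otimes\mu)$; and each $\iota_i:X_i\to\Lambda_i$ is a measurable function such that $(x,y)\mapsto d_{\Lambda_i}(\iota_i(x),\iota_i(y))$ belongs to $L^2(\mu_i\otimes\mu_i)$. Let $\mathcal{LP}_k$ be the collection of these. $L$ and $L'$ are weakly isomorphic if there are $\overline L=\big((\overline X_i,\overline\mu_i),\overline\omega,(\overline\iota_i)\big)\in\mathcal{LP}_k$ and measurable maps $\phi_i:\overline X_i\to X_i$, $\phi_i':\overline X_i\to X_i'$ with $(\phi_i)_\#\overline\mu_i=\mu_i$, $(\phi'_i)_\#\overline\mu_i=\mu'_i$ such that,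 for all $i,j$, $\overline\omega(x,y)=\omega(\phi_i(x),\phi_j(y))=\omega'(\phi_i'(x),\phi_j'(y))$ for $\overline\mu_i\otimes\overline\mu_j$-almost every $(x,y)$, and $\overline\iota_i(x)=\iota_i(\phi_i(x))=\iota_i'(\phi_i'(x))$ for $\overline\mu_i$-almost every $x$. Put $$d_{\mathcal{LP}_k}(L,L')=\inf_{(\pi_i)}\ \frac12\Big(\sum_{i,j=1}^k\big\|\omega(x,y)-\omega'(x',y')\big\|^2_{L^2(\pi_i(dx,dx')\otimes\pi_j(dy,dy'))}+\sum_{i=1}^k\big\|d_{\Lambda_i}(\iota_i(x),\iota_i'(x'))\big\|^2_{L^2(\pi_i(dx,dx'))}\Big)^{1/2},$$ where the infimum is over all tuples in which $\pi_i$ is a coupling of $\mu_i$ and $\mu_i'$, $1\le i\le k$. Then weak isomorphism is an equivalence relation on $\mathcal{LP}_k$, $d_{\mathcal{LP}_k}$ induces a well-defined (finite) metric on the quotient $[\mathcal{LP}_k]$, and $([\mathcal{LP}_k],d_{\mathcal{LP}_k})$ is an Alexandrov space of non-negative curvature. That is, writing $d=d_{\mathcal{LP}_k}$ and calling a map $\gamma:[0,1]\to[\mathcal{LP}_k]$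 a geodesic if $d(\gamma(s),\gamma(t))=(t-s)\,d(\gamma(0),\gamma(1))$ for all $0\le s\le t\le1$: the space is complete; any two points are the endpoints $\gamma(0),\gamma(1)$ of a geodesic; and for every geodesic $\gamma$, every point $x$ and every $t\in[0,1]$, $$d(\gamma(t),x)^2\ \ge\ (1-t)\,d(\gamma(0),x)^2+t\,d(\gamma(1),x)^2-t(1-t)\,d(\gamma(0),\gamma(1))^2 .$$ -/

import Mathlib

open MeasureTheory
open scoped ENNReal

universe u v

/-! ### Alexandrov spaces of non-negative curvature -/

/-- `γ : [0,1] → X` is a geodesic (from `γ 0` to `γ 1`):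
`d (γ s) (γ t) = (t - s) d (γ 0) (γ 1)` for all `0 ≤ s ≤ t ≤ 1`. -/
def IsGeodesic {X : Type u} [MetricSpace X] (γ : unitInterval → X) : Prop :=
  ∀ s t : unitInterval, s ≤ t → dist (γ s) (γ t) = ((t : ℝ) - (s : ℝ)) * dist (γ 0) (γ 1)

/-- Any two points are joined by a geodesic. -/
def IsGeodesicSpace (X : Type u) [MetricSpace X] : Prop :=
  ∀ x y : X, ∃ γ : unitInterval → X, IsGeodesic γ ∧ γ 0 = x ∧ γ 1 = y

/-- The triangle comparison inequality expressing that the curvature is bounded below by zero. -/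
def CurvatureBoundedBelowByZero (X : Type u) [MetricSpace X] : Prop :=
  ∀ γ : unitInterval → X, IsGeodesic γ → ∀ (x : X) (t : unitInterval),
    (1 - (t : ℝ)) * dist (γ 0) x ^ 2 + (t : ℝ) * dist (γ 1) x ^ 2
      - (t : ℝ) * (1 - (t : ℝ)) * dist (γ 0) (γ 1) ^ 2 ≤ dist (γ t) x ^ 2

/-- A complete geodesic space with curvature bounded below by zero. -/
structure IsAlexandrovNonneg (X : Type u) [MetricSpace X] : Prop where
  complete : CompleteSpace X
  geodesic : IsGeodesicSpace X
  curvature : CurvatureBoundedBelowByZero X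

/-! ### Labelled partitioned measure networks -/

/-- A `k`-partitioned measure `2`-network. The disjoint union `X = ⊔ i, X i` of the Polish
probability spaces `(X i, μ i)` is kept as the family of its pieces; so a kernel
`ω : X × X → [0, ∞)` is the family of its blocks `ω i j : X i × X j → [0, ∞)`, and, since
`μ ⊗ μ = ∑ i j, μ i ⊗ μ j` for `μ = ∑ i, μ i`, being in `L²(μ ⊗ μ)` means that every block is
in `L²(μ i ⊗ μ j)`. -/
structure PartitionedNetwork (k : ℕ) where
  X : Fin k → Type u
  [top : ∀ i, TopologicalSpace (X i)]
  [polish : ∀ i, PolishSpace (X i)]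
  [meas : ∀ i, MeasurableSpace (X i)]
  [borel : ∀ i, BorelSpace (X i)]
  μ : ∀ i, Measure (X i)
  [prob : ∀ i, IsProbabilityMeasure (μ i)]
  ω : ∀ i j, X i → X j → ℝ
  ω_nonneg : ∀ i j x y, 0 ≤ ω i j x y
  ω_memLp : ∀ i j, MemLp (fun z : X i × X j => ω i j z.1 z.2) 2 ((μ i).prod (μ j))

attribute [instance] PartitionedNetwork.top PartitionedNetwork.polish PartitionedNetwork.meas
  PartitionedNetwork.borel PartitionedNetwork.prob

/-- A labelled `k`-partitioned measure `2`-network with label spaces `Λ i`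
(metric spaces carrying their Borel σ-algebras). -/
structure LabelledNetwork {k : ℕ} (Λ : Fin k → Type v) [∀ i, MetricSpace (Λ i)]
    [∀ i, MeasurableSpace (Λ i)] extends PartitionedNetwork.{u} k where
  ι : ∀ i, X i → Λ i
  ι_measurable : ∀ i, Measurable (ι i)
  ι_memLp : ∀ i, MemLp (fun z : X i × X i => dist (ι i z.1) (ι i z.2)) 2 ((μ i).prod (μ i))

/-- `π` is a coupling of `μ` and `ν`. -/
structure IsCoupling {X : Type u} {Y : Type v} [MeasurableSpace X] [MeasurableSpace Y]
    (μ : Measure X) (ν : Measure Y) (π : Measure (X × Y)) : Prop where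
  map_fst : π.map Prod.fst = μ
  map_snd : π.map Prod.snd = ν

/-- `φ` is a weak isomorphism from `P` to `P'`. -/
structure PartitionedNetwork.IsWeakIso {k : ℕ} (P P' : PartitionedNetwork.{u} k)
    (φ : ∀ i, P.X i → P'.X i) : Prop where
  measurePreserving : ∀ i, MeasurePreserving (φ i) (P.μ i) (P'.μ i)
  kernel_eq : ∀ i j, ∀ᵐ z ∂((P.μ i).prod (P.μ j)),
    P.ω i j z.1 z.2 = P'.ω i j (φ i z.1) (φ j z.2)

namespace LabelledNetwork

variable {k : ℕ} {Λ : Fin k → Type v} [∀ i, MetricSpace (Λ i)] [∀ i, MeasurableSpace (Λ i)]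

/-- Weak isomorphism of labelled partitioned measure networks. -/
def WeaklyIsomorphic (L L' : LabelledNetwork.{u} Λ) : Prop :=
  ∃ (M : LabelledNetwork.{u} Λ) (φ : ∀ i, M.X i → L.X i) (φ' : ∀ i, M.X i → L'.X i),
    M.toPartitionedNetwork.IsWeakIso L.toPartitionedNetwork φ ∧
    M.toPartitionedNetwork.IsWeakIso L'.toPartitionedNetwork φ' ∧
    ∀ i, ∀ᵐ x ∂(M.μ i), M.ι i x = L.ι i (φ i x) ∧ M.ι i x = L'.ι i (φ' i x)

/-- The sum of the squared `L²`-norms of `ω - ω'` with respect to `π i ⊗ π j` and of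
`(x, x') ↦ d (ι i x) (ι' i x')` with respect to `π i`. -/
noncomputable def cost (L L' : LabelledNetwork.{u} Λ) (π : ∀ i, Measure (L.X i × L'.X i)) :
    ℝ≥0∞ :=
  (∑ i, ∑ j, eLpNorm (fun z : (L.X i × L'.X i) × (L.X j × L'.X j) =>
      L.ω i j z.1.1 z.2.1 - L'.ω i j z.1.2 z.2.2) 2 ((π i).prod (π j)) ^ 2)
  + ∑ i, eLpNorm (fun z : L.X i × L'.X i => dist (L.ι i z.1) (L'.ι i z.2)) 2 (π i) ^ 2

/-- The labelled `k`-partitioned network distance (for `p = 2`), with values in `[0, ∞]`: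
the infimum over all `k`-partitioned couplings `π` of half the square root of the cost. -/
noncomputable def networkDist (L L' : LabelledNetwork.{u} Λ) : ℝ≥0∞ :=
  ⨅ (π : ∀ i, Measure (L.X i × L'.X i)) (_ : ∀ i, IsCoupling (L.μ i) (L'.μ i) (π i)),
    (1 / 2) * (cost L L' π) ^ (1 / 2 : ℝ)

end LabelledNetwork

/-- The space of labelled `k`-partitioned measure `2`-networks modulo weak isomorphism. -/
def LabelledNetworkClass {k : ℕ} (Λ : Fin k → Type v) [∀ i, MetricSpace (Λ i)]
    [∀ i, MeasurableSpace (Λ i)] : Type (max (u + 1) v) :=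
  Quot (LabelledNetwork.WeaklyIsomorphic.{u} (Λ := Λ))

/-- The weak isomorphism class of a labelled network. -/
def LabelledNetwork.toClass {k : ℕ} {Λ : Fin k → Type v} [∀ i, MetricSpace (Λ i)]
    [∀ i, MeasurableSpace (Λ i)] (L : LabelledNetwork.{u} Λ) : LabelledNetworkClass.{u} Λ :=
  Quot.mk _ L

/-! Realize the networks on common probability spaces. Pulled back along measure preserving maps, a
network becomes a vector of kernels and labels in the Hilbert space `NetSpace`, and the cost of a
coupling is the squared distance between the two pullbacks. So the network distance is half an
infimum of Hilbert distances, much as the Wasserstein distance arises from `L²` spaces of maps.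

Two facts make this effective. The infimum is attained (`exists_optimal_coupling`): couplings form a
weakly compact set, and the cost is continuous on it because the marginals are fixed. Couplings can
also be glued by disintegration, with the old distances preserved (`exists_extension`,
`exists_sequence_gluing`).

Gluing two optimal couplings gives the triangle inequality. Distance zero means that two pullbacks
coincide, which is weak isomorphism. Segments between optimally placed vectors give geodesics, since
non-negative kernels form a convex cone. For curvature, three networks are glued optimally to the
intermediate point of a geodesic. The remaining distances are then only bounded above by Hilbert
ones, which is the direction required, and the Hilbert identity for a point on a segment concludes.
For completeness, a whole fast Cauchy sequence is glued and its limit taken in `NetSpace`.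

Since the label spaces may be non-separable, it must also be shown that Borel labels are almost
everywhere strongly measurable; this is a cardinality argument. -/

/-! ### Borel maps into non-separable metric spaces. -/

section EssentialSeparability

open Cardinal Set

variable {X : Type*} [MeasurableSpace X] [StandardBorelSpace X]

/-- A standard Borel space carries at most continuum many measurable sets. -/
theorem mk_measurableSet_le_continuum (X : Type*) [MeasurableSpace X] [StandardBorelSpace X] :
    #{t : Set X | MeasurableSet t} ≤ 𝔠 := by
  obtain ⟨b, hb, h⟩ := MeasurableSpace.CountablyGenerated.isCountablyGenerated (α := X)
  subst h
  refine MeasurableSpace.cardinal_measurableSet_le_continuum ?_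
  exact (Cardinal.le_aleph0_iff_set_countable.2 hb).trans Cardinal.aleph0_le_continuum

/-- In a Polish space, a set of positive finite measure meets some compact set in positive
measure. -/
theorem exists_isCompact_inter_ne_zero {X : Type*} [TopologicalSpace X] [PolishSpace X]
    [MeasurableSpace X] [BorelSpace X] (μ : Measure X) [IsFiniteMeasure μ] {s : Set X}
    (hs : μ s ≠ 0) : ∃ K : Set X, IsCompact K ∧ μ (s ∩ K) ≠ 0 := by
  have htight := isTightMeasureSet_singleton (μ := μ)
  rw [isTightMeasureSet_iff_exists_isCompact_measure_compl_le] at htight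
  obtain ⟨K, hKc, hK⟩ := htight (μ s / 2) (ENNReal.half_pos hs)
  refine ⟨K, hKc, fun h0 => ?_⟩
  have h2 : μ s ≤ μ s / 2 := by
    calc μ s ≤ μ (s ∩ K) + μ (s \ K) := (measure_inter_add_sdiff _ hKc.measurableSet).ge
      _ ≤ 0 + μ Kᶜ := add_le_add h0.le (measure_mono fun x hx => hx.2)
      _ ≤ _ := by rw [zero_add]; exact hK _ rfl
  exact absurd h2 (not_le.2 (ENNReal.half_lt_self hs (measure_ne_top _ _)))

/-- A map to the reals all of whose preimages are measurable is concentrated on a countable set. -/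
theorem exists_countable_of_measurableSet_preimage_real (μ : Measure X) [IsFiniteMeasure μ]
    (f : X → ℝ) (hf : ∀ A : Set ℝ, MeasurableSet (f ⁻¹' A)) :
    ∃ C : Set ℝ, C.Countable ∧ μ (f ⁻¹' Cᶜ) = 0 := by
  -- The candidate is the set of atoms of the image measure; the point is that no diffuse part
  -- remains.
  refine ⟨{s | 0 < μ (f ⁻¹' {s})}, ?_, ?_⟩
  · refine Measure.countable_meas_pos_of_disjoint_iUnion (fun s => hf {s}) ?_
    intro s t hst
    exact Disjoint.preimage f (by simpa using hst)
  set C : Set ℝ := {s | 0 < μ (f ⁻¹' {s})}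
  by_contra hpos
  have hK : ∃ K : Set X, IsCompact (f '' K) ∧ μ (f ⁻¹' Cᶜ ∩ K) ≠ 0 := by
    let tX := upgradeStandardBorel X
    have hfm : Measurable f := fun A _ => hf A
    -- A finer Polish topology with the same Borel sets makes `f` continuous, so that compact sets
    -- have compact images.
    obtain ⟨τ, hle, hcont, hpol⟩ := hfm.exists_continuous
    have hbor : @BorelSpace X τ _ := by
      refine @BorelSpace.mk _ τ _ ?_
      rw [borel_eq_borel_of_le hpol (t' := tX.toTopologicalSpace) inferInstance hle]
      exact BorelSpace.measurable_eq
    obtain ⟨K, hKc, hK⟩ := @exists_isCompact_inter_ne_zero X τ hpol _ hbor μ _ _ hpos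
    exact ⟨K, @IsCompact.image _ _ τ _ _ _ hKc hcont, hK⟩
  obtain ⟨K, hKc, hK⟩ := hK
  have hunc : ¬ (f '' K).Countable := by
    intro hcount
    apply hK
    have hsub : f ⁻¹' Cᶜ ∩ K ⊆ ⋃ s ∈ f '' K ∩ Cᶜ, f ⁻¹' {s} := by
      rintro x ⟨hx, hxK⟩
      simp only [mem_iUnion]
      exact ⟨f x, ⟨mem_image_of_mem _ hxK, hx⟩, rfl⟩
    refine measure_mono_null hsub ((measure_biUnion_null_iff (hcount.mono inter_subset_left)).2 ?_)
    rintro s ⟨-, hs⟩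
    simpa [C] using hs
  -- An uncountable closed set contains a copy of the Cantor space. Its `2 ^ 𝔠` subsets have
  -- distinct measurable preimages, but there are at most `𝔠` measurable sets.
  obtain ⟨j, hj, -, hjinj⟩ := hKc.isClosed.exists_nat_bool_injection_of_not_countable hunc
  have hinj : Function.Injective
      (fun A : Set (ℕ → Bool) => (⟨f ⁻¹' (j '' A), hf _⟩ : {t : Set X | MeasurableSet t})) := by
    intro A B hAB
    have hAB' : f ⁻¹' (j '' A) = f ⁻¹' (j '' B) := congrArg Subtype.val hAB
    have hr : range j ⊆ range f := hj.trans (image_subset_range _ _)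
    have := preimage_eq_preimage' ((image_subset_range _ _).trans hr)
      ((image_subset_range _ _).trans hr) |>.1 hAB'
    exact hjinj.image_injective this
  have h1 := Cardinal.lift_mk_le_lift_mk_of_injective hinj
  have h2 := h1.trans (Cardinal.lift_le.2 (mk_measurableSet_le_continuum X))
  simp only [Cardinal.mk_set, Cardinal.mk_pi, Cardinal.mk_bool] at h2
  simp at h2
  exact absurd (Cardinal.cantor 𝔠) (not_lt.2 h2)

/-- A map all of whose preimages are measurable is concentrated on a countable set. -/
theorem exists_countable_of_measurableSet_preimage (μ : Measure X) [IsFiniteMeasure μ]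
    {S : Type*} (f : X → S) (hf : ∀ A : Set S, MeasurableSet (f ⁻¹' A)) :
    ∃ C : Set S, C.Countable ∧ μ (f ⁻¹' Cᶜ) = 0 := by
  rcases isEmpty_or_nonempty X with hX | hX
  · exact ⟨∅, countable_empty, by simp [Set.eq_empty_of_isEmpty]⟩
  -- Coding a value by a chosen preimage is injective on the range of `f`, which reduces the claim
  -- to real values.
  let g : S → ℝ := fun s => embeddingReal X (Function.invFun f s)
  have hg : ∀ x y, g (f x) = g (f y) → f x = f y := by
    intro x y h
    have := (measurableEmbedding_embeddingReal X).injective h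
    rw [← Function.invFun_eq (f := f) ⟨x, rfl⟩, this, Function.invFun_eq (f := f) ⟨y, rfl⟩]
  obtain ⟨C, hC, h0⟩ := exists_countable_of_measurableSet_preimage_real μ (g ∘ f)
    (fun A => hf (g ⁻¹' A))
  refine ⟨range f ∩ g ⁻¹' C, ?_, ?_⟩
  · have hinj : InjOn g (range f) := by
      rintro _ ⟨x, rfl⟩ _ ⟨y, rfl⟩ h
      exact hg x y h
    exact MapsTo.countable_of_injOn (f := g) (t := C) (fun s hs => hs.2)
      (hinj.mono inter_subset_left) hC
  · refine measure_mono_null ?_ h0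
    intro x hx hxC
    exact hx ⟨mem_range_self x, hxC⟩

/-- Every metric space has, for each `ε > 0`, a self-map moving points by less than `ε` all of
whose preimages are Borel. -/
theorem exists_discretization {Y : Type*} [PseudoMetricSpace Y] [MeasurableSpace Y]
    [BorelSpace Y] {ε : ℝ} (hε : 0 < ε) :
    ∃ r : Y → Y, (∀ y, dist y (r y) < ε) ∧ ∀ A : Set Y, MeasurableSet (r ⁻¹' A) := by
  -- For a well-ordering of `Y`, `r y` is the least point within `ε` of `y`.
  let R : Y → Y → Prop := WellOrderingRel
  have hwf : WellFounded R := IsWellFounded.wf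
  have hne : ∀ y : Y, {s : Y | dist y s < ε}.Nonempty := fun y => ⟨y, by simpa using hε⟩
  let r : Y → Y := fun y => hwf.min _ (hne y)
  have hr : ∀ y, dist y (r y) < ε := fun y => hwf.min_mem _ (hne y)
  have hmin : ∀ y s, dist y s < ε → ¬ R s (r y) := fun y s hs => hwf.not_lt_min _ hs
  refine ⟨r, hr, fun A => ?_⟩
  -- The margin `1 / (n + 1)` makes `r` locally constant: each of two closer points may use the
  -- centre of the other, so the least centres agree. Hence every `E n` is closed.
  let E : ℕ → Set Y := fun n => {y | r y ∈ A ∧ dist y (r y) ≤ ε - 1 / (n + 1)}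
  have hsep : ∀ (n : ℕ) (y z : Y), dist y (r y) ≤ ε - 1 / (n + 1) →
      dist z (r z) ≤ ε - 1 / (n + 1) → dist y z < 1 / (n + 1) → r y = r z := by
    intro n y z hy hz hyz
    rcases trichotomous_of R (r y) (r z) with h | h | h
    · refine absurd h (hmin z _ ?_)
      linarith [dist_triangle z y (r y), dist_comm y z]
    · exact h
    · refine absurd h (hmin y _ ?_)
      linarith [dist_triangle y z (r z)]
  have hunion : r ⁻¹' A = ⋃ n, E n := by
    ext y
    simp only [mem_preimage, mem_iUnion, E, mem_ofPred_eq]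
    refine ⟨fun h => ?_, fun ⟨n, h, _⟩ => h⟩
    obtain ⟨n, hn⟩ := exists_nat_one_div_lt (sub_pos.2 (hr y))
    exact ⟨n, h, by linarith⟩
  rw [hunion]
  refine MeasurableSet.iUnion fun n => IsClosed.measurableSet ?_
  refine isClosed_of_closure_subset fun y hy => ?_
  have hδ : (0 : ℝ) < 1 / (n + 1) := Nat.one_div_pos_of_nat
  have hd : (0 : ℝ) < 1 / (n + 1) / 2 := half_pos hδ
  obtain ⟨z, hz, hyz⟩ := Metric.mem_closure_iff.1 hy _ hd
  have hle : dist y (r z) ≤ ε - 1 / (n + 1) := by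
    refine le_of_forall_pos_lt_add fun η hη => ?_
    obtain ⟨w, hw, hyw⟩ := Metric.mem_closure_iff.1 hy _ (lt_min hd hη)
    have hwz : r w = r z := hsep n w z hw.2 hz.2 (by
      linarith [dist_triangle_left w z y, lt_min_iff.1 hyw])
    have := hw.2
    rw [hwz] at this
    linarith [dist_triangle y w (r z), lt_min_iff.1 hyw]
  -- A smaller `r y` would be admissible for points of `E n` close enough to `y`, all of which have
  -- centre `r z`; a smaller `r z` would be admissible for `y` by `hle`.
  have hyr : r y = r z := by
    rcases trichotomous_of R (r y) (r z) with h | h | h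
    · obtain ⟨w, hw, hyw⟩ := Metric.mem_closure_iff.1 hy _ (lt_min hd (sub_pos.2 (hr y)))
      have hwz : r w = r z := hsep n w z hw.2 hz.2 (by
        linarith [dist_triangle_left w z y, lt_min_iff.1 hyw])
      refine absurd (hwz ▸ h) (hmin w _ ?_)
      linarith [dist_triangle_left w (r y) y, lt_min_iff.1 hyw]
    · exact h
    · exact absurd h (hmin y _ (by linarith))
  exact ⟨hyr ▸ hz.1, hyr ▸ hle⟩

/-- A Borel map from a standard Borel space to a metric space is almost everywhere strongly
measurable for every finite measure, without any separability of the target. -/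
theorem Measurable.aestronglyMeasurable_of_standardBorel (μ : Measure X) [IsFiniteMeasure μ]
    {Y : Type*} [MetricSpace Y] [MeasurableSpace Y] [BorelSpace Y] {f : X → Y}
    (hf : Measurable f) : AEStronglyMeasurable f μ := by
  rw [aestronglyMeasurable_iff_aemeasurable_separable]
  refine ⟨hf.aemeasurable, ?_⟩
  choose r hr hrm using fun n : ℕ => exists_discretization (Y := Y) (ε := 1 / ((n : ℝ) + 1))
    Nat.one_div_pos_of_nat
  -- Each discretization of `f` is essentially countably valued, so almost every value of `f` is a
  -- limit of points from countably many centres.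
  choose C hC hC0 using fun n : ℕ => exists_countable_of_measurableSet_preimage μ (r n ∘ f)
    (fun A => hf (hrm n A))
  refine ⟨closure (⋃ n, C n), (countable_iUnion hC).isSeparable.closure, ?_⟩
  have : ∀ᵐ x ∂μ, ∀ n, r n (f x) ∈ C n := by
    rw [ae_all_iff]
    exact fun n => hC0 n
  filter_upwards [this] with x hx
  refine Metric.mem_closure_iff.2 fun ε hε => ?_
  obtain ⟨n, hn⟩ := exists_nat_one_div_lt hε
  exact ⟨r n (f x), mem_iUnion.2 ⟨n, hx n⟩, (hr n _).trans hn⟩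

end EssentialSeparability

/-! ### Networks as vectors of a Hilbert space. -/

section NetSpace

variable {k : ℕ} {Λ : Fin k → Type v} [∀ i, NormedAddCommGroup (Λ i)]
  [∀ i, MeasurableSpace (Λ i)] [∀ i, BorelSpace (Λ i)]

/-- The labels of a network with labels in normed spaces are square integrable. -/
theorem LabelledNetwork.memLp_label (L : LabelledNetwork.{u} Λ) (i : Fin k) :
    MemLp (L.ι i) 2 (L.μ i) := by
  have hm : AEStronglyMeasurable (L.ι i) (L.μ i) :=
    (L.ι_measurable i).aestronglyMeasurable_of_standardBorel _
  -- By Fubini, the distance to some fixed label is square integrable, and constants are too.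
  have hint := ((L.ι_memLp i).integrable_sq).prod_right_ae
  obtain ⟨x, hx⟩ := hint.exists
  have hd : MemLp (fun y => L.ι i x - L.ι i y) 2 (L.μ i) := by
    refine (memLp_two_iff_integrable_sq_norm (aestronglyMeasurable_const.sub hm)).2 ?_
    simp only [dist_eq_norm] at hx
    exact hx
  have := (memLp_const (L.ι i x)).sub hd
  refine this.ae_eq (Filter.Eventually.of_forall fun y => ?_)
  simp

/-- The Hilbert space of square integrable kernels and labels on a family of measured spaces. -/
abbrev NetSpace (Λ : Fin k → Type v) [∀ i, NormedAddCommGroup (Λ i)] {Ω : Fin k → Type*}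
    [∀ i, MeasurableSpace (Ω i)] (P : ∀ i, Measure (Ω i)) : Type _ :=
  WithLp 2 (PiLp 2 (fun p : Fin k × Fin k => Lp ℝ 2 ((P p.1).prod (P p.2))) ×
    PiLp 2 (fun i => Lp (Λ i) 2 (P i)))

/-- The kernels of an element of `NetSpace` are non-negative. -/
def NetSpace.KernelNonneg {k : ℕ} {Λ : Fin k → Type v}
    [∀ i, NormedAddCommGroup (Λ i)] {Ω : Fin k → Type*} [∀ i, MeasurableSpace (Ω i)]
    {P : ∀ i, Measure (Ω i)} (v : NetSpace Λ P) : Prop := ∀ p, 0 ≤ v.fst p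

theorem NetSpace.isClosed_kernelNonneg {k : ℕ} {Λ : Fin k → Type v}
    [∀ i, NormedAddCommGroup (Λ i)] {Ω : Fin k → Type*} [∀ i, MeasurableSpace (Ω i)]
    {P : ∀ i, Measure (Ω i)} :
    IsClosed {v : NetSpace Λ P | v.KernelNonneg} := by
  have : {v : NetSpace Λ P | v.KernelNonneg} = ⋂ p, {v | 0 ≤ v.fst p} := by
    ext v; simp [NetSpace.KernelNonneg]
  rw [this]
  refine isClosed_iInter fun p => isClosed_le continuous_const ?_
  fun_prop

namespace LabelledNetwork

variable {Ω : Fin k → Type*} [∀ i, MeasurableSpace (Ω i)] {P : ∀ i, Measure (Ω i)}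
  [∀ i, IsProbabilityMeasure (P i)]

omit [∀ i, BorelSpace (Λ i)] in
theorem memLp_kernel_comp (L : LabelledNetwork.{u} Λ) {φ : ∀ i, Ω i → L.X i}
    (hφ : ∀ i, MeasurePreserving (φ i) (P i) (L.μ i)) (i j : Fin k) :
    MemLp (fun z : Ω i × Ω j => L.ω i j (φ i z.1) (φ j z.2)) 2 ((P i).prod (P j)) :=
  (L.ω_memLp i j).comp_measurePreserving ((hφ i).prod (hφ j))

omit [∀ i, IsProbabilityMeasure (P i)] in
theorem memLp_label_comp (L : LabelledNetwork.{u} Λ) {φ : ∀ i, Ω i → L.X i}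
    (hφ : ∀ i, MeasurePreserving (φ i) (P i) (L.μ i)) (i : Fin k) :
    MemLp (fun x => L.ι i (φ i x)) 2 (P i) :=
  (L.memLp_label i).comp_measurePreserving (hφ i)

/-- The kernels and labels of a network, pulled back along measure preserving maps. -/
noncomputable def pullback (L : LabelledNetwork.{u} Λ) (φ : ∀ i, Ω i → L.X i)
    (hφ : ∀ i, MeasurePreserving (φ i) (P i) (L.μ i)) : NetSpace Λ P :=
  WithLp.toLp 2
    (WithLp.toLp 2 fun p => (L.memLp_kernel_comp hφ p.1 p.2).toLp _,
    WithLp.toLp 2 fun i => (L.memLp_label_comp hφ i).toLp _)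

/-- The distance depends on the realization only through the joint laws of `φ i` and `φ' i`, by
change of variables. -/
theorem edist_pullback (L L' : LabelledNetwork.{u} Λ) {φ : ∀ i, Ω i → L.X i}
    (hφ : ∀ i, MeasurePreserving (φ i) (P i) (L.μ i)) {φ' : ∀ i, Ω i → L'.X i}
    (hφ' : ∀ i, MeasurePreserving (φ' i) (P i) (L'.μ i)) :
    edist (L.pullback φ hφ) (L'.pullback φ' hφ') =
      cost L L' (fun i => (P i).map fun x => (φ i x, φ' i x)) ^ (1 / 2 : ℝ) := by
  obtain ⟨π, hπ⟩ : ∃ π : ∀ i, Measure (L.X i × L'.X i),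
      π = fun i => (P i).map fun x => (φ i x, φ' i x) := ⟨_, rfl⟩
  have hmp : ∀ i, MeasurePreserving (fun x => (φ i x, φ' i x)) (P i) (π i) := fun i =>
    ⟨(hφ i).measurable.prodMk (hφ' i).measurable, by rw [hπ]⟩
  have : ∀ i, IsProbabilityMeasure (π i) := fun i => by
    rw [← (hmp i).map_eq]
    exact Measure.isProbabilityMeasure_map (hmp i).measurable.aemeasurable
  have hfst : ∀ i, MeasurePreserving Prod.fst (π i) (L.μ i) := fun i =>
    ⟨measurable_fst, by
      rw [← (hmp i).map_eq, Measure.map_map measurable_fst (hmp i).measurable]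
      exact (hφ i).map_eq⟩
  have hsnd : ∀ i, MeasurePreserving Prod.snd (π i) (L'.μ i) := fun i =>
    ⟨measurable_snd, by
      rw [← (hmp i).map_eq, Measure.map_map measurable_snd (hmp i).measurable]
      exact (hφ' i).map_eq⟩
  rw [← hπ]
  have hker : ∀ i j, edist ((L.pullback φ hφ).fst (i, j)) ((L'.pullback φ' hφ').fst (i, j)) =
      eLpNorm (fun z : (L.X i × L'.X i) × (L.X j × L'.X j) =>
        L.ω i j z.1.1 z.2.1 - L'.ω i j z.1.2 z.2.2) 2 ((π i).prod (π j)) := by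
    intro i j
    have hmeas : AEStronglyMeasurable (fun z : (L.X i × L'.X i) × (L.X j × L'.X j) =>
        L.ω i j z.1.1 z.2.1 - L'.ω i j z.1.2 z.2.2) ((π i).prod (π j)) :=
      (L.memLp_kernel_comp hfst i j).1.sub (L'.memLp_kernel_comp hsnd i j).1
    rw [← eLpNorm_comp_measurePreserving hmeas ((hmp i).prod (hmp j))]
    exact Lp.edist_toLp_toLp _ _ (L.memLp_kernel_comp hφ i j) (L'.memLp_kernel_comp hφ' i j)
  have hlab : ∀ i, edist ((L.pullback φ hφ).snd i) ((L'.pullback φ' hφ').snd i) =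
      eLpNorm (fun z : L.X i × L'.X i => dist (L.ι i z.1) (L'.ι i z.2)) 2 (π i) := by
    intro i
    have hmeas : AEStronglyMeasurable (fun z : L.X i × L'.X i => L.ι i z.1 - L'.ι i z.2) (π i) :=
      (L.memLp_label_comp hfst i).1.sub (L'.memLp_label_comp hsnd i).1
    simp only [dist_eq_norm]
    rw [eLpNorm_norm, ← eLpNorm_comp_measurePreserving hmeas (hmp i)]
    exact Lp.edist_toLp_toLp _ _ (L.memLp_label_comp hφ i) (L'.memLp_label_comp hφ' i)
  rw [WithLp.prod_edist_eq_of_L2, PiLp.edist_eq_of_L2, PiLp.edist_eq_of_L2]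
  congr 1
  rw [← ENNReal.rpow_natCast, ← ENNReal.rpow_natCast, ← ENNReal.rpow_mul, ← ENNReal.rpow_mul]
  norm_num
  simp only [cost, Fintype.sum_prod_type, hker, hlab]

theorem networkDist_le_edist_pullback (L L' : LabelledNetwork.{u} Λ) {φ : ∀ i, Ω i → L.X i}
    (hφ : ∀ i, MeasurePreserving (φ i) (P i) (L.μ i)) {φ' : ∀ i, Ω i → L'.X i}
    (hφ' : ∀ i, MeasurePreserving (φ' i) (P i) (L'.μ i)) :
    networkDist L L' ≤ 1 / 2 * edist (L.pullback φ hφ) (L'.pullback φ' hφ') := by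
  rw [edist_pullback]
  refine iInf₂_le (fun i => (P i).map fun x => (φ i x, φ' i x)) fun i => ⟨?_, ?_⟩
  · rw [Measure.map_map measurable_fst ((hφ i).measurable.prodMk (hφ' i).measurable)]
    exact (hφ i).map_eq
  · rw [Measure.map_map measurable_snd ((hφ i).measurable.prodMk (hφ' i).measurable)]
    exact (hφ' i).map_eq

/-- Passing to a common extension does not change the distance between pullbacks. -/
theorem edist_pullback_comp (L L' : LabelledNetwork.{u} Λ) {φ : ∀ i, Ω i → L.X i}
    (hφ : ∀ i, MeasurePreserving (φ i) (P i) (L.μ i)) {φ' : ∀ i, Ω i → L'.X i}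
    (hφ' : ∀ i, MeasurePreserving (φ' i) (P i) (L'.μ i)) {Ω' : Fin k → Type*}
    [∀ i, MeasurableSpace (Ω' i)] {P' : ∀ i, Measure (Ω' i)} [∀ i, IsProbabilityMeasure (P' i)]
    {ψ : ∀ i, Ω' i → Ω i} (hψ : ∀ i, MeasurePreserving (ψ i) (P' i) (P i)) :
    edist (L.pullback (fun i => φ i ∘ ψ i) fun i => (hφ i).comp (hψ i))
        (L'.pullback (fun i => φ' i ∘ ψ i) fun i => (hφ' i).comp (hψ i)) =
      edist (L.pullback φ hφ) (L'.pullback φ' hφ') := by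
  rw [edist_pullback, edist_pullback]
  congr 2
  funext i
  have : (fun x => ((φ i ∘ ψ i) x, (φ' i ∘ ψ i) x)) = (fun x => (φ i x, φ' i x)) ∘ ψ i := rfl
  rw [this, ← Measure.map_map ((hφ i).measurable.prodMk (hφ' i).measurable) (hψ i).measurable,
    (hψ i).map_eq]

end LabelledNetwork

section OfNetSpace

variable {Ω : Fin k → Type u} [∀ i, TopologicalSpace (Ω i)] [∀ i, PolishSpace (Ω i)]
  [∀ i, MeasurableSpace (Ω i)] [∀ i, BorelSpace (Ω i)] {P : ∀ i, Measure (Ω i)}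
  [∀ i, IsProbabilityMeasure (P i)]

/-- The network on a family of Polish probability spaces given by square integrable kernels
(replaced by their absolute values) and labels. -/
noncomputable def NetSpace.toNetwork (v : NetSpace Λ P) : LabelledNetwork.{u} Λ where
  X := Ω
  μ := P
  ω i j x y := |v.fst (i, j) (x, y)|
  ω_nonneg _ _ _ _ := abs_nonneg _
  ω_memLp i j := (Lp.memLp (v.fst (i, j))).norm
  ι i := v.snd i
  ι_measurable i := (Lp.stronglyMeasurable (v.snd i)).measurable
  ι_memLp i := by
    have h := Lp.memLp (v.snd i)
    have h1 : MemLp (fun z : Ω i × Ω i => v.snd i z.1) 2 ((P i).prod (P i)) :=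
      h.comp_measurePreserving measurePreserving_fst
    have h2 : MemLp (fun z : Ω i × Ω i => v.snd i z.2) 2 ((P i).prod (P i)) :=
      h.comp_measurePreserving measurePreserving_snd
    simp only [dist_eq_norm]
    exact (h1.sub h2).norm

/-- The absolute value in `toNetwork` changes an almost everywhere non-negative kernel only on a
null set. -/
theorem NetSpace.pullback_toNetwork {v : NetSpace Λ P} (hv : v.KernelNonneg) :
    v.toNetwork.pullback (P := P) (fun _ => id) (fun i => MeasurePreserving.id (P i)) = v := by
  refine WithLp.ofLp_injective 2 (Prod.ext (WithLp.ofLp_injective 2 (funext fun p => ?_))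
    (WithLp.ofLp_injective 2 (funext fun i => ?_)))
  · refine Lp.ext ((MemLp.coeFn_toLp (v.toNetwork.memLp_kernel_comp
      (fun i => MeasurePreserving.id (P i)) p.1 p.2)).trans ?_)
    filter_upwards [(Lp.coeFn_nonneg _).2 (hv p)] with x hx
    exact abs_of_nonneg hx
  · exact Lp.ext (MemLp.coeFn_toLp (v.toNetwork.memLp_label_comp
      (fun i => MeasurePreserving.id (P i)) i))

end OfNetSpace

section KernelNonneg

variable {Ω : Fin k → Type*} [∀ i, MeasurableSpace (Ω i)] {P : ∀ i, Measure (Ω i)}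
  [∀ i, IsProbabilityMeasure (P i)]

theorem LabelledNetwork.kernelNonneg_pullback (L : LabelledNetwork.{u} Λ) {φ : ∀ i, Ω i → L.X i}
    (hφ : ∀ i, MeasurePreserving (φ i) (P i) (L.μ i)) : (L.pullback φ hφ).KernelNonneg := by
  intro p
  refine (Lp.coeFn_nonneg _).1 ?_
  filter_upwards [MemLp.coeFn_toLp (L.memLp_kernel_comp hφ p.1 p.2)] with x hx
  exact (L.ω_nonneg _ _ _ _).trans hx.ge

theorem LabelledNetwork.pullback_eq_pullback_iff (L L' : LabelledNetwork.{u} Λ)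
    {φ : ∀ i, Ω i → L.X i} (hφ : ∀ i, MeasurePreserving (φ i) (P i) (L.μ i))
    {φ' : ∀ i, Ω i → L'.X i} (hφ' : ∀ i, MeasurePreserving (φ' i) (P i) (L'.μ i)) :
    L.pullback φ hφ = L'.pullback φ' hφ' ↔
      (∀ i j, ∀ᵐ z ∂(P i).prod (P j),
        L.ω i j (φ i z.1) (φ j z.2) = L'.ω i j (φ' i z.1) (φ' j z.2)) ∧
      ∀ i, ∀ᵐ x ∂P i, L.ι i (φ i x) = L'.ι i (φ' i x) := by
  constructor
  · intro h
    refine ⟨fun i j => ?_, fun i => ?_⟩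
    · have := congrArg (fun v : NetSpace Λ P => v.fst (i, j)) h
      exact (MemLp.toLp_eq_toLp_iff (L.memLp_kernel_comp hφ i j)
        (L'.memLp_kernel_comp hφ' i j)).1 this
    · have := congrArg (fun v : NetSpace Λ P => v.snd i) h
      exact (MemLp.toLp_eq_toLp_iff (L.memLp_label_comp hφ i) (L'.memLp_label_comp hφ' i)).1 this
  · rintro ⟨h1, h2⟩
    refine WithLp.ofLp_injective 2 (Prod.ext (WithLp.ofLp_injective 2 (funext fun p => ?_))
      (WithLp.ofLp_injective 2 (funext fun i => ?_)))
    · exact (MemLp.toLp_eq_toLp_iff (L.memLp_kernel_comp hφ p.1 p.2)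
        (L'.memLp_kernel_comp hφ' p.1 p.2)).2 (h1 p.1 p.2)
    · exact (MemLp.toLp_eq_toLp_iff (L.memLp_label_comp hφ i) (L'.memLp_label_comp hφ' i)).2 (h2 i)

end KernelNonneg

end NetSpace

/-! ### Existence of optimal couplings. -/

section OptimalCoupling

open scoped BoundedContinuousFunction NNReal

variable {Y Y' E : Type*} [TopologicalSpace Y] [PolishSpace Y] [MeasurableSpace Y] [BorelSpace Y]
  [TopologicalSpace Y'] [PolishSpace Y'] [MeasurableSpace Y'] [BorelSpace Y']
  [NormedAddCommGroup E] {T : Type*} [TopologicalSpace T]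

-- The squared integrand is bounded and continuous, so weak convergence applies to it directly.
omit [PolishSpace Y] in
theorem continuous_eLpNorm_boundedContinuous {Q : T → ProbabilityMeasure (Y × Y')}
    (hQ : Continuous Q) (g : Y →ᵇ E) (g' : Y' →ᵇ E) :
    Continuous fun t => eLpNorm (fun z : Y × Y' => g z.1 - g' z.2) 2 (Q t : Measure (Y × Y')) := by
  let h0 : Y × Y' →ᵇ E := g.compContinuous ⟨Prod.fst, continuous_fst⟩ -
    g'.compContinuous ⟨Prod.snd, continuous_snd⟩
  let h : Y × Y' →ᵇ ℝ≥0 := h0.normComp.nnrealPart * h0.normComp.nnrealPart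
  have hlin : Continuous fun t => ∫⁻ z, h z ∂(Q t : Measure (Y × Y')) := by
    rw [continuous_iff_continuousAt] at hQ ⊢
    exact fun t => ProbabilityMeasure.tendsto_iff_forall_lintegral_tendsto.1 (hQ t) h
  have : (fun t => eLpNorm (fun z : Y × Y' => g z.1 - g' z.2) 2 (Q t : Measure (Y × Y'))) =
      fun t => (∫⁻ z, h z ∂(Q t : Measure (Y × Y'))) ^ (1 / 2 : ℝ) := by
    funext t
    rw [eLpNorm_eq_lintegral_rpow_enorm_toReal (by norm_num) (by norm_num)]
    simp only [ENNReal.toReal_ofNat]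
    congr 1
    refine lintegral_congr fun z => ?_
    have hz : h z = ‖g z.1 - g' z.2‖₊ * ‖g z.1 - g' z.2‖₊ := by
      rw [← norm_toNNReal]
      rfl
    rw [ENNReal.rpow_ofNat, pow_two, hz, ENNReal.coe_mul]
    rfl
  rw [this]
  exact ENNReal.continuous_rpow_const.comp hlin

/-- Along a continuous family of couplings, the `L²`-distance of two fixed square integrable
functions is continuous. -/
theorem continuous_eLpNorm_sub_of_coupling [NormedSpace ℝ E] {Q : T → ProbabilityMeasure (Y × Y')}
    (hQ : Continuous Q) {ν : Measure Y} {ν' : Measure Y'} [IsProbabilityMeasure ν]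
    [IsProbabilityMeasure ν']
    (h1 : ∀ t, (Q t : Measure (Y × Y')).map Prod.fst = ν)
    (h2 : ∀ t, (Q t : Measure (Y × Y')).map Prod.snd = ν') {f : Y → E} {f' : Y' → E}
    (hf : MemLp f 2 ν) (hf' : MemLp f' 2 ν') :
    Continuous fun t => eLpNorm (fun z : Y × Y' => f z.1 - f' z.2) 2 (Q t : Measure (Y × Y')) := by
  have hp1 : ∀ t, MeasurePreserving Prod.fst (Q t : Measure (Y × Y')) ν :=
    fun t => ⟨measurable_fst, h1 t⟩
  have hp2 : ∀ t, MeasurePreserving Prod.snd (Q t : Measure (Y × Y')) ν' :=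
    fun t => ⟨measurable_snd, h2 t⟩
  have hmem : ∀ {u : Y → E} {u' : Y' → E}, MemLp u 2 ν → MemLp u' 2 ν' → ∀ t,
      MemLp (fun z : Y × Y' => u z.1 - u' z.2) 2 (Q t : Measure (Y × Y')) := fun hu hu' t =>
    (hu.comp_measurePreserving (hp1 t)).sub (hu'.comp_measurePreserving (hp2 t))
  -- The error of replacing the functions is measured by the fixed marginals, hence uniform in `t`;
  -- bounded continuous approximation then suffices.
  have hlip : ∀ {u w : Y → E} {u' w' : Y' → E}, MemLp u 2 ν → MemLp u' 2 ν' → MemLp w 2 ν →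
      MemLp w' 2 ν' → ∀ t, eLpNorm (fun z : Y × Y' => u z.1 - u' z.2) 2 (Q t : Measure (Y × Y')) ≤
        eLpNorm (fun z : Y × Y' => w z.1 - w' z.2) 2 (Q t : Measure (Y × Y')) +
          (eLpNorm (u - w) 2 ν + eLpNorm (u' - w') 2 ν') := by
    intro u w u' w' hu hu' hw hw' t
    have e1 := (eLpNorm_comp_measurePreserving (p := 2) (hu.sub hw).1 (hp1 t))
    have e2 := (eLpNorm_comp_measurePreserving (p := 2) (hu'.sub hw').1 (hp2 t))
    rw [← e1, ← e2]
    have hd1 : AEStronglyMeasurable ((u - w) ∘ Prod.fst) (Q t : Measure (Y × Y')) :=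
      ((hu.sub hw).comp_measurePreserving (hp1 t)).1
    have hd2 : AEStronglyMeasurable ((u' - w') ∘ Prod.snd) (Q t : Measure (Y × Y')) :=
      ((hu'.sub hw').comp_measurePreserving (hp2 t)).1
    have heq : (fun z : Y × Y' => u z.1 - u' z.2) = (fun z : Y × Y' => w z.1 - w' z.2) +
        ((u - w) ∘ Prod.fst - (u' - w') ∘ Prod.snd) := by
      funext z
      simp only [Pi.add_apply, Pi.sub_apply, Function.comp_apply]
      abel
    rw [heq]
    refine (eLpNorm_add_le (hmem hw hw' t).1 (hd1.sub hd2) (by norm_num)).trans ?_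
    gcongr
    exact eLpNorm_sub_le hd1 hd2 (by norm_num)
  have hreal : Continuous fun t =>
      (eLpNorm (fun z : Y × Y' => f z.1 - f' z.2) 2 (Q t : Measure (Y × Y'))).toReal := by
    refine continuous_of_uniform_approx_of_continuous fun U hU => ?_
    obtain ⟨ε, hε, hεU⟩ := Metric.mem_uniformity_dist.1 hU
    have hε4 : ENNReal.ofReal (ε / 4) ≠ 0 := by
      rw [Ne, ENNReal.ofReal_eq_zero, not_le]; linarith
    obtain ⟨g, hg, hgm⟩ := hf.exists_boundedContinuous_eLpNorm_sub_le (by norm_num) hε4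
    obtain ⟨g', hg', hgm'⟩ := hf'.exists_boundedContinuous_eLpNorm_sub_le (by norm_num) hε4
    refine ⟨fun t => (eLpNorm (fun z : Y × Y' => g z.1 - g' z.2) 2
      (Q t : Measure (Y × Y'))).toReal, ?_, fun t => hεU ?_⟩
    · have hc := continuous_eLpNorm_boundedContinuous hQ g g'
      rw [continuous_iff_continuousAt] at hc ⊢
      exact fun t => (ENNReal.tendsto_toReal (hmem hgm hgm' t).eLpNorm_ne_top).comp (hc t)
    · have hsum : eLpNorm (f - ⇑g) 2 ν + eLpNorm (f' - ⇑g') 2 ν' ≤ ENNReal.ofReal (ε / 2) := by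
        refine (add_le_add hg hg').trans ?_
        rw [← ENNReal.ofReal_add (by linarith) (by linarith)]
        exact ENNReal.ofReal_le_ofReal (by linarith)
      have hsum' : eLpNorm (⇑g - f) 2 ν + eLpNorm (⇑g' - f') 2 ν' ≤ ENNReal.ofReal (ε / 2) := by
        rwa [eLpNorm_sub_comm, eLpNorm_sub_comm (f := ⇑g')]
      have key : ∀ {a b c : ℝ≥0∞}, b ≠ ∞ → a ≤ b + c → c ≤ ENNReal.ofReal (ε / 2) →
          a.toReal ≤ b.toReal + ε / 2 := by
        intro a b c hb h hc
        have := ENNReal.toReal_mono (by finiteness) (h.trans (add_le_add_right hc b))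
        rwa [ENNReal.toReal_add hb (by finiteness), ENNReal.toReal_ofReal (by linarith)] at this
      have k1 := key (hmem hgm hgm' t).eLpNorm_ne_top (hlip hf hf' hgm hgm' t) hsum
      have k2 := key (hmem hf hf' t).eLpNorm_ne_top (hlip hgm hgm' hf hf' t) hsum'
      rw [Real.dist_eq, abs_lt]
      constructor <;> linarith
  refine (ENNReal.continuous_ofReal.comp hreal).congr fun t => ?_
  exact ENNReal.ofReal_toReal (hmem hf hf' t).eLpNorm_ne_top

/-- The probability measures on a product with given marginals. -/
def couplingSet (ν : Measure Y) (ν' : Measure Y') : Set (ProbabilityMeasure (Y × Y')) :=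
  {π | IsCoupling ν ν' (π : Measure (Y × Y'))}

theorem isCompact_couplingSet (ν : Measure Y) (ν' : Measure Y') [IsProbabilityMeasure ν]
    [IsProbabilityMeasure ν'] : IsCompact (couplingSet ν ν') := by
  have hclosed : IsClosed (couplingSet ν ν') := by
    have : couplingSet ν ν' =
        {π | π.map (f := Prod.fst) measurable_fst.aemeasurable = ⟨ν, inferInstance⟩} ∩
        {π | π.map (f := Prod.snd) measurable_snd.aemeasurable = ⟨ν', inferInstance⟩} := by
      ext π
      refine ⟨fun h => ⟨Subtype.ext h.1, Subtype.ext h.2⟩, fun h =>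
        ⟨congrArg Subtype.val h.1, congrArg Subtype.val h.2⟩⟩
    rw [this]
    exact (isClosed_eq (ProbabilityMeasure.continuous_map continuous_fst) continuous_const).inter
      (isClosed_eq (ProbabilityMeasure.continuous_map continuous_snd) continuous_const)
  rw [← hclosed.closure_eq]
  -- Prokhorov: tightness of the marginals gives tightness of the couplings.
  refine isCompact_closure_of_isTightMeasureSet (IsTightMeasureSet.prodMk ?_ ?_)
  · refine (isTightMeasureSet_singleton (μ := ν)).subset ?_
    rintro _ ⟨_, ⟨π, hπ, rfl⟩, rfl⟩
    exact hπ.1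
  · refine (isTightMeasureSet_singleton (μ := ν')).subset ?_
    rintro _ ⟨_, ⟨π, hπ, rfl⟩, rfl⟩
    exact hπ.2

namespace LabelledNetwork

variable {k : ℕ} {Λ : Fin k → Type v} [∀ i, NormedAddCommGroup (Λ i)]
  [∀ i, NormedSpace ℝ (Λ i)]  [∀ i, MeasurableSpace (Λ i)] [∀ i, BorelSpace (Λ i)]

/-- The infimum in the definition of the network distance is attained. -/
theorem exists_optimal_coupling (L L' : LabelledNetwork.{u} Λ) :
    ∃ π : ∀ i, Measure (L.X i × L'.X i), (∀ i, IsCoupling (L.μ i) (L'.μ i) (π i)) ∧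
      networkDist L L' = 1 / 2 * cost L L' π ^ (1 / 2 : ℝ) := by
  let C : ∀ i, Set (ProbabilityMeasure (L.X i × L'.X i)) := fun i => couplingSet (L.μ i) (L'.μ i)
  have hcomp : IsCompact (Set.univ.pi C) := isCompact_univ_pi fun i => isCompact_couplingSet _ _
  have hne : (Set.univ.pi C).Nonempty := by
    refine ⟨fun i => ⟨(L.μ i).prod (L'.μ i), inferInstance⟩, fun i _ => ⟨?_, ?_⟩⟩
    · exact measurePreserving_fst.map_eq
    · exact measurePreserving_snd.map_eq
  have hcont : ContinuousOn (fun π : ∀ i, ProbabilityMeasure (L.X i × L'.X i) =>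
      cost L L' fun i => (π i : Measure (L.X i × L'.X i))) (Set.univ.pi C) := by
    rw [continuousOn_iff_continuous_domRestrict]
    have hev : ∀ i, Continuous fun π : Set.univ.pi C => π.1 i := fun i =>
      (continuous_apply i).comp continuous_subtype_val
    have hc1 : ∀ (π : Set.univ.pi C) i, MeasurePreserving Prod.fst
        (π.1 i : Measure (L.X i × L'.X i)) (L.μ i) :=
      fun π i => ⟨measurable_fst, (π.2 i (Set.mem_univ i)).1⟩
    have hc2 : ∀ (π : Set.univ.pi C) i, MeasurePreserving Prod.snd
        (π.1 i : Measure (L.X i × L'.X i)) (L'.μ i) :=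
      fun π i => ⟨measurable_snd, (π.2 i (Set.mem_univ i)).2⟩
    refine Continuous.add (continuous_finsetSum _ fun i _ => continuous_finsetSum _ fun j _ =>
      (ENNReal.continuous_pow 2).comp ?_)
      (continuous_finsetSum _ fun i _ => (ENNReal.continuous_pow 2).comp ?_)
    -- Regrouping coordinates turns the product of two couplings into a coupling of product
    -- measures, so kernels are treated like labels.
    · let σ : (L.X i × L'.X i) × (L.X j × L'.X j) → (L.X i × L.X j) × (L'.X i × L'.X j) :=
        fun z => ((z.1.1, z.2.1), (z.1.2, z.2.2))
      have hσ : Continuous σ := by fun_prop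
      let Q : Set.univ.pi C → ProbabilityMeasure ((L.X i × L.X j) × (L'.X i × L'.X j)) :=
        fun π => ((π.1 i).prod (π.1 j)).map hσ.measurable.aemeasurable
      have hQ : Continuous Q := (ProbabilityMeasure.continuous_map hσ).comp
        (ProbabilityMeasure.continuous_prod.comp ((hev i).prodMk (hev j)))
      have hσQ : ∀ π, MeasurePreserving σ
          ((π.1 i : Measure (L.X i × L'.X i)).prod (π.1 j : Measure (L.X j × L'.X j)))
          (Q π : Measure ((L.X i × L.X j) × (L'.X i × L'.X j))) := fun π => ⟨hσ.measurable, rfl⟩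
      have hQ1 : ∀ π, (Q π : Measure ((L.X i × L.X j) × (L'.X i × L'.X j))).map Prod.fst = (L.μ i).prod (L.μ j) := fun π => by
        rw [← (hσQ π).map_eq, Measure.map_map measurable_fst hσ.measurable]
        exact ((hc1 π i).prod (hc1 π j)).map_eq
      have hQ2 : ∀ π, (Q π : Measure ((L.X i × L.X j) × (L'.X i × L'.X j))).map Prod.snd = (L'.μ i).prod (L'.μ j) := fun π => by
        rw [← (hσQ π).map_eq, Measure.map_map measurable_snd hσ.measurable]
        exact ((hc2 π i).prod (hc2 π j)).map_eq
      refine (continuous_eLpNorm_sub_of_coupling hQ hQ1 hQ2 (L.ω_memLp i j)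
        (L'.ω_memLp i j)).congr fun π => ?_
      have hm : AEStronglyMeasurable (fun z : (L.X i × L.X j) × (L'.X i × L'.X j) =>
          L.ω i j z.1.1 z.1.2 - L'.ω i j z.2.1 z.2.2) (Q π : Measure ((L.X i × L.X j) × (L'.X i × L'.X j))) :=
        ((L.ω_memLp i j).comp_measurePreserving ⟨measurable_fst, hQ1 π⟩).1.sub
          ((L'.ω_memLp i j).comp_measurePreserving ⟨measurable_snd, hQ2 π⟩).1
      exact (eLpNorm_comp_measurePreserving hm (hσQ π)).symm
    · simp only [dist_eq_norm, eLpNorm_norm]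
      exact continuous_eLpNorm_sub_of_coupling (hev i) (fun π => (hc1 π i).map_eq)
        (fun π => (hc2 π i).map_eq) (L.memLp_label i) (L'.memLp_label i)
  obtain ⟨π, hπC, hπ⟩ := hcomp.exists_isMinOn hne hcont
  refine ⟨fun i => π i, fun i => hπC i (Set.mem_univ i), le_antisymm
    (iInf₂_le (fun i => (π i : Measure (L.X i × L'.X i))) fun i => hπC i (Set.mem_univ i)) ?_⟩
  refine le_iInf₂ fun ρ hρ => ?_
  have hprob : ∀ i, IsProbabilityMeasure (ρ i) := fun i => ⟨by
    have h := congrArg (fun m => m Set.univ) (hρ i).map_fst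
    simpa [Measure.map_apply measurable_fst MeasurableSet.univ] using h⟩
  gcongr
  exact hπ (a := fun i => ⟨ρ i, hprob i⟩) fun i _ => hρ i

end LabelledNetwork

end OptimalCoupling

/-! ### Gluing couplings by disintegration. -/

section Gluing

open ProbabilityTheory

theorem map_compProd_comap {A B C : Type*} [MeasurableSpace A] [MeasurableSpace B]
    [MeasurableSpace C] (ρ : Measure A) [IsProbabilityMeasure ρ] (κ : Kernel B C)
    [IsMarkovKernel κ] {φ : A → B} (hφ : Measurable φ) :
    (ρ ⊗ₘ κ.comap φ hφ).map (Prod.map φ id) = (ρ.map φ) ⊗ₘ κ := by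
  have := Measure.isProbabilityMeasure_map (μ := ρ) hφ.aemeasurable
  have hm : Measurable (Prod.map φ (id : C → C)) := hφ.prodMap measurable_id
  ext s hs
  rw [Measure.map_apply hm hs, Measure.compProd_apply (hm hs), Measure.compProd_apply hs,
    lintegral_map (Kernel.measurable_kernel_prodMk_left hs) hφ]
  rfl

/-- Gluing: a coupling can be realized on an extension of any space mapping to its first factor. -/
theorem exists_extension_of_coupling {Ω X X' : Type*} [MeasurableSpace Ω] [MeasurableSpace X]
    [MeasurableSpace X'] [StandardBorelSpace X'] {P : Measure Ω} [IsProbabilityMeasure P]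
    {μ : Measure X} {μ' : Measure X'} [IsProbabilityMeasure μ] [IsProbabilityMeasure μ']
    {φ : Ω → X} (hφ : MeasurePreserving φ P μ) {π : Measure (X × X')} (hπ : IsCoupling μ μ' π) :
    ∃ R : Measure (Ω × X'), IsProbabilityMeasure R ∧ MeasurePreserving Prod.fst R P ∧
      MeasurePreserving Prod.snd R μ' ∧ R.map (fun z => (φ z.1, z.2)) = π := by
  have : Nonempty X' := nonempty_of_isProbabilityMeasure μ'
  have hprob : IsProbabilityMeasure π := ⟨by
    have h := congrArg (fun m => m Set.univ) hπ.map_fst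
    simpa [Measure.map_apply measurable_fst MeasurableSet.univ] using h⟩
  have hfst : π.fst = μ := hπ.map_fst
  -- The second coordinate is drawn from the conditional law of `π` given `φ`; only `X'` needs to be
  -- standard Borel.
  let R := P ⊗ₘ π.condKernel.comap φ hφ.measurable
  have hR : R.map (fun z => (φ z.1, z.2)) = π := by
    refine (map_compProd_comap P π.condKernel hφ.measurable).trans ?_
    rw [hφ.map_eq, ← hfst, Measure.disintegrate]
  refine ⟨R, inferInstance, ⟨measurable_fst, Measure.fst_compProd _ _⟩, ⟨measurable_snd, ?_⟩, hR⟩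
  rw [← hπ.map_snd, ← hR, Measure.map_map measurable_snd (by have := hφ.measurable; fun_prop)]
  rfl

/-- Gluing of infinitely many consecutive couplings. -/
theorem exists_sequence_gluing {X : ℕ → Type*} [∀ n, MeasurableSpace (X n)]
    [∀ n, StandardBorelSpace (X n)] {μ : ∀ n, Measure (X n)} [∀ n, IsProbabilityMeasure (μ n)]
    {π : ∀ n, Measure (X n × X (n + 1))} (hπ : ∀ n, IsCoupling (μ n) (μ (n + 1)) (π n)) :
    ∃ R : Measure (∀ n, X n), IsProbabilityMeasure R ∧
      (∀ n, MeasurePreserving (fun x => x n) R (μ n)) ∧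
      ∀ n, R.map (fun x => (x n, x (n + 1))) = π n := by
  have : ∀ n, Nonempty (X n) := fun n => nonempty_of_isProbabilityMeasure (μ n)
  have hprob : ∀ n, IsProbabilityMeasure (π n) := fun n => ⟨by
    have h := congrArg (fun m => m Set.univ) (hπ n).map_fst
    simpa [Measure.map_apply measurable_fst MeasurableSet.univ] using h⟩
  have hfst : ∀ n, (π n).fst = μ n := fun n => (hπ n).map_fst
  let last : ∀ n, (∀ i : Finset.Iic n, X i) → X n := fun n x => x ⟨n, Finset.mem_Iic.2 le_rfl⟩
  have hlast : ∀ n, Measurable (last n) := fun n => measurable_pi_apply _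
  -- The gluing is a Markov chain (Ionescu-Tulcea): the next coordinate depends on the past only
  -- through the last one.
  let κ : ∀ n, Kernel (∀ i : Finset.Iic n, X i) (X (n + 1)) := fun n =>
    (π n).condKernel.comap (last n) (hlast n)
  let R := Kernel.trajMeasure (μ 0) κ
  have hzero : R.map (fun x => x 0) = μ 0 := by
    let e : X 0 → ∀ i : Finset.Iic 0, X i :=
      (MeasurableEquiv.piUnique (fun i : Finset.Iic 0 => X i)).symm
    have he : Measurable e := (MeasurableEquiv.piUnique (fun i : Finset.Iic 0 => X i)).symm.measurable
    have h1 : R.map (Preorder.frestrictLe 0) = (μ 0).map e := by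
      simp only [R, Kernel.trajMeasure]
      rw [Measure.map_comp _ _ (by fun_prop), Kernel.traj_map_frestrictLe,
        Kernel.partialTraj_self, Measure.id_comp]
      rfl
    have h2 : (fun x : ∀ n, X n => x 0) = last 0 ∘ Preorder.frestrictLe 0 := rfl
    rw [h2, ← Measure.map_map (hlast 0) (by fun_prop), h1,
      Measure.map_map (hlast 0) he]
    exact Measure.map_id
  have hstep : ∀ n, R.map (fun x => x n) = μ n → R.map (fun x => (x n, x (n + 1))) = π n := by
    intro n hn
    have h1 := Kernel.map_frestrictLe_trajMeasure_compProd_eq_map_trajMeasure (μ₀ := μ 0) (κ := κ)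
      (a := n)
    have hm : Measurable (Prod.map (last n) (id : X (n + 1) → X (n + 1))) :=
      (hlast n).prodMap measurable_id
    have : IsProbabilityMeasure (R.map (Preorder.frestrictLe n)) :=
      Measure.isProbabilityMeasure_map (by fun_prop)
    have h2 := congrArg (fun m => m.map (Prod.map (last n) (id : X (n + 1) → X (n + 1)))) h1
    have h3 := map_compProd_comap (R.map (Preorder.frestrictLe n)) (π n).condKernel (hlast n)
    rw [Measure.map_map (hlast n) (by fun_prop)] at h3
    have h4 : last n ∘ Preorder.frestrictLe n = fun x : ∀ n, X n => x n := rfl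
    rw [h4, hn, ← hfst, Measure.disintegrate] at h3
    rw [← h3]
    refine Eq.trans ?_ h2.symm
    rw [Measure.map_map hm (by fun_prop)]
    rfl
  have hmarg : ∀ n, R.map (fun x => x n) = μ n := by
    intro n
    induction n with
    | zero => exact hzero
    | succ n ih =>
      rw [← (hπ n).map_snd, ← hstep n ih, Measure.map_map measurable_snd (by fun_prop)]
      rfl
  exact ⟨R, inferInstance, fun n => ⟨measurable_pi_apply n, hmarg n⟩, fun n => hstep n (hmarg n)⟩

end Gluing

/-! ### Metric properties of the network distance. -/

section NetworkDistance

open Filter Topology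

variable {k : ℕ} {Λ : Fin k → Type v} [∀ i, NormedAddCommGroup (Λ i)]
  [∀ i, InnerProductSpace ℝ (Λ i)] [∀ i, MeasurableSpace (Λ i)] [∀ i, BorelSpace (Λ i)]

namespace LabelledNetwork

/-- Two networks can be realized at optimal distance on an extension of any family of spaces on
which the first one is realized. -/
theorem exists_extension (L L' : LabelledNetwork.{u} Λ) {Ω : Fin k → Type*}
    [∀ i, MeasurableSpace (Ω i)] {P : ∀ i, Measure (Ω i)} [∀ i, IsProbabilityMeasure (P i)]
    {φ : ∀ i, Ω i → L.X i} (hφ : ∀ i, MeasurePreserving (φ i) (P i) (L.μ i)) :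
    ∃ (R : ∀ i, Measure (Ω i × L'.X i)) (_ : ∀ i, IsProbabilityMeasure (R i))
      (h1 : ∀ i, MeasurePreserving Prod.fst (R i) (P i))
      (h2 : ∀ i, MeasurePreserving Prod.snd (R i) (L'.μ i)),
      networkDist L L' = 1 / 2 * edist
        (L.pullback (fun i => φ i ∘ Prod.fst) fun i => (hφ i).comp (h1 i))
        (L'.pullback (fun _ => Prod.snd) h2) := by
  obtain ⟨π, hπ, hopt⟩ := exists_optimal_coupling L L'
  choose R hR h1 h2 h3 using fun i => exists_extension_of_coupling (hφ i) (hπ i)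
  refine ⟨R, hR, h1, h2, ?_⟩
  rw [hopt, edist_pullback]
  congr 3
  funext i
  exact (h3 i).symm

theorem exists_realization (L L' : LabelledNetwork.{u} Λ) :
    ∃ (R : ∀ i, Measure (L.X i × L'.X i)) (_ : ∀ i, IsProbabilityMeasure (R i))
      (h1 : ∀ i, MeasurePreserving Prod.fst (R i) (L.μ i))
      (h2 : ∀ i, MeasurePreserving Prod.snd (R i) (L'.μ i)),
      networkDist L L' = 1 / 2 * edist (L.pullback (fun _ => Prod.fst) h1)
        (L'.pullback (fun _ => Prod.snd) h2) :=
  exists_extension L L' fun i => MeasurePreserving.id (L.μ i)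

theorem networkDist_ne_top (L L' : LabelledNetwork.{u} Λ) : networkDist L L' ≠ ∞ := by
  obtain ⟨R, _, h1, h2, h⟩ := exists_realization L L'
  rw [h]
  exact ENNReal.mul_ne_top (by norm_num) (edist_ne_top _ _)

theorem networkDist_comm (L L' : LabelledNetwork.{u} Λ) : networkDist L L' = networkDist L' L := by
  have : ∀ L L' : LabelledNetwork.{u} Λ, networkDist L' L ≤ networkDist L L' := by
    intro L L'
    obtain ⟨R, _, h1, h2, h⟩ := exists_realization L L'
    rw [h, edist_comm]
    exact networkDist_le_edist_pullback L' L h2 h1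
  exact le_antisymm (this _ _) (this _ _)

theorem networkDist_triangle (L₁ L₂ L₃ : LabelledNetwork.{u} Λ) :
    networkDist L₁ L₃ ≤ networkDist L₁ L₂ + networkDist L₂ L₃ := by
  obtain ⟨R, _, h1, h2, h⟩ := exists_realization L₁ L₂
  obtain ⟨S, _, g1, g2, g⟩ := exists_extension L₂ L₃ h2
  rw [h, g, ← edist_pullback_comp L₁ L₂ h1 h2 g1, ← mul_add]
  refine (networkDist_le_edist_pullback L₁ L₃ (fun i => (h1 i).comp (g1 i)) g2).trans ?_
  gcongr
  exact edist_triangle _ _ _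

/-- Networks are at distance zero exactly when they are weakly isomorphic. -/
theorem networkDist_eq_zero_iff {L L' : LabelledNetwork.{u} Λ} :
    networkDist L L' = 0 ↔ WeaklyIsomorphic L L' := by
  constructor
  · intro h0
    obtain ⟨R, _, h1, h2, h⟩ := exists_realization L L'
    have heq : L.pullback (fun _ => Prod.fst) h1 = L'.pullback (fun _ => Prod.snd) h2 := by
      rw [h0] at h
      simpa using h.symm
    -- The coupled space with the common pullback is itself a network, and serves as the common
    -- extension.
    let v := L.pullback (fun _ => Prod.fst) h1
    have hid := NetSpace.pullback_toNetwork (L.kernelNonneg_pullback h1)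
    have e1 := (pullback_eq_pullback_iff _ _ _ h1).1 hid
    have e2 := (pullback_eq_pullback_iff _ _ _ h2).1 (hid.trans heq)
    refine ⟨v.toNetwork, fun _ => Prod.fst, fun _ => Prod.snd, ⟨h1, fun i j => e1.1 i j⟩,
      ⟨h2, fun i j => e2.1 i j⟩, fun i => ?_⟩
    filter_upwards [e1.2 i, e2.2 i] with x hx hx'
    exact ⟨hx, hx'⟩
  · rintro ⟨M, φ, φ', h, h', hι⟩
    have heq : L.pullback φ h.measurePreserving = L'.pullback φ' h'.measurePreserving := by
      rw [pullback_eq_pullback_iff]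
      refine ⟨fun i j => ?_, fun i => ?_⟩
      · filter_upwards [h.kernel_eq i j, h'.kernel_eq i j] with z hz hz'
        exact hz.symm.trans hz'
      · filter_upwards [hι i] with x hx
        exact hx.1.symm.trans hx.2
    have := networkDist_le_edist_pullback L L' h.measurePreserving h'.measurePreserving
    rw [heq, edist_self, mul_zero] at this
    exact le_antisymm this zero_le

theorem equivalence_weaklyIsomorphic :
    Equivalence (WeaklyIsomorphic.{u} (Λ := Λ)) where
  refl L := by
    refine ⟨L, fun _ => id, fun _ => id, ?_, ?_, fun i => ae_of_all _ fun x => ⟨rfl, rfl⟩⟩ <;>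
    exact ⟨fun i => MeasurePreserving.id _, fun i j => ae_of_all _ fun z => rfl⟩
  symm h := by rwa [← networkDist_eq_zero_iff, networkDist_comm, networkDist_eq_zero_iff]
  trans {L₁ L₂ L₃} h h' := by
    rw [← networkDist_eq_zero_iff] at h h' ⊢
    exact le_antisymm ((networkDist_triangle L₁ L₂ L₃).trans (by rw [h, h', add_zero]))
      zero_le

end LabelledNetwork

omit [∀ i, MeasurableSpace (Λ i)] [∀ i, BorelSpace (Λ i)] in
theorem NetSpace.KernelNonneg.lineMap {Ω : Fin k → Type*} [∀ i, MeasurableSpace (Ω i)]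
    {P : ∀ i, Measure (Ω i)} {v w : NetSpace Λ P} (hv : v.KernelNonneg) (hw : w.KernelNonneg)
    (t : unitInterval) : (AffineMap.lineMap v w (t : ℝ) : NetSpace Λ P).KernelNonneg := by
  intro p
  rw [AffineMap.lineMap_apply_module]
  have hsmul : ∀ {c : ℝ} {f : Lp ℝ 2 ((P p.1).prod (P p.2))}, 0 ≤ c → 0 ≤ f → 0 ≤ c • f := by
    intro c f hc hf
    rw [← Lp.coeFn_nonneg] at hf ⊢
    filter_upwards [hf, Lp.coeFn_smul c f] with z hz hcz
    rw [hcz]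
    exact mul_nonneg hc hz
  exact add_nonneg (hsmul (sub_nonneg.2 t.2.2) (hv p)) (hsmul t.2.1 (hw p))

/-- If `b` lies on a metric geodesic from `a` to `c`, the comparison inequality at `b` holds
for every point `e`. -/
theorem norm_sub_sq_comparison {H : Type*} [NormedAddCommGroup H] [InnerProductSpace ℝ H]
    {a b c e : H} {t D : ℝ} (ht0 : 0 ≤ t) (ht1 : t ≤ 1) (hab : ‖a - b‖ = t * D)
    (hcb : ‖c - b‖ = (1 - t) * D) (hac : D ≤ ‖a - c‖) (hD : 0 ≤ D) :
    (1 - t) * ‖a - e‖ ^ 2 + t * ‖c - e‖ ^ 2 - t * (1 - t) * D ^ 2 ≤ ‖b - e‖ ^ 2 := by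
  have hid : ∀ p q : H, ‖(1 - t) • p + t • q‖ ^ 2 =
      (1 - t) * ‖p‖ ^ 2 + t * ‖q‖ ^ 2 - t * (1 - t) * ‖p - q‖ ^ 2 := by
    intro p q
    rw [norm_add_sq_real, norm_sub_sq_real, norm_smul, norm_smul, real_inner_smul_left,
      real_inner_smul_right, mul_pow, mul_pow, Real.norm_eq_abs, Real.norm_eq_abs, sq_abs, sq_abs]
    ring
  have htt : 0 ≤ t * (1 - t) := mul_nonneg ht0 (sub_nonneg.2 ht1)
  -- The assumed distances force `b` to be the point of parameter `t` on the segment from `a` to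
  -- `c`.
  have hzero : (1 - t) • (a - b) + t • (c - b) = 0 := by
    have h := hid (a - b) (c - b)
    rw [sub_sub_sub_cancel_right, hab, hcb] at h
    have h2 : t * (1 - t) * D ^ 2 ≤ t * (1 - t) * ‖a - c‖ ^ 2 :=
      mul_le_mul_of_nonneg_left (pow_le_pow_left₀ hD hac 2) htt
    have h3 : ‖(1 - t) • (a - b) + t • (c - b)‖ ^ 2 ≤ 0 := by
      rw [h]
      linarith [show (1 - t) * (t * D) ^ 2 + t * ((1 - t) * D) ^ 2 = t * (1 - t) * D ^ 2 by ring]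
    exact norm_eq_zero.1 (pow_eq_zero_iff two_ne_zero |>.1 (le_antisymm h3 (sq_nonneg _)))
  have hb : b - e = (1 - t) • (a - e) + t • (c - e) := by
    have : (1 - t) • (a - e) + t • (c - e) =
        ((1 - t) • (a - b) + t • (c - b)) + (b - e) := by module
    rw [this, hzero, zero_add]
  have hle : ‖a - c‖ ≤ D := by
    have := norm_sub_le_norm_sub_add_norm_sub a b c
    rw [hab, norm_sub_rev b c, hcb] at this
    linarith
  rw [hb, hid, sub_sub_sub_cancel_right]
  have := mul_le_mul_of_nonneg_left (pow_le_pow_left₀ (norm_nonneg _) hle 2) htt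
  linarith

/-! ### The Alexandrov space of weak isomorphism classes. -/

namespace LabelledNetworkClass

open LabelledNetwork

theorem networkDist_congr_right (L : LabelledNetwork.{u} Λ) {L₁ L₂ : LabelledNetwork.{u} Λ}
    (h : WeaklyIsomorphic L₁ L₂) : networkDist L L₁ = networkDist L L₂ := by
  have h0 := networkDist_eq_zero_iff.2 h
  refine le_antisymm ((networkDist_triangle L L₂ L₁).trans ?_)
    ((networkDist_triangle L L₁ L₂).trans ?_)
  · rw [networkDist_comm L₂ L₁, h0, add_zero]
  · rw [h0, add_zero]

/-- The network distance as a metric on weak isomorphism classes. -/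
noncomputable instance instMetricSpace : MetricSpace (LabelledNetworkClass.{u} Λ) where
  dist := Quot.lift₂ (fun L L' => (networkDist L L').toReal)
    (fun L L₁ L₂ h => by rw [networkDist_congr_right L h])
    (fun L₁ L₂ L h => by
      rw [networkDist_comm L₁, networkDist_comm L₂, networkDist_congr_right L h])
  dist_self := by
    rintro ⟨L⟩
    change (networkDist L L).toReal = 0
    rw [networkDist_eq_zero_iff.2 (equivalence_weaklyIsomorphic.refl L), ENNReal.toReal_zero]
  dist_comm := by
    rintro ⟨L⟩ ⟨L'⟩
    exact congrArg ENNReal.toReal (networkDist_comm L L')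
  dist_triangle := by
    rintro ⟨L₁⟩ ⟨L₂⟩ ⟨L₃⟩
    change (networkDist L₁ L₃).toReal ≤ (networkDist L₁ L₂).toReal + (networkDist L₂ L₃).toReal
    rw [← ENNReal.toReal_add (networkDist_ne_top _ _) (networkDist_ne_top _ _)]
    exact ENNReal.toReal_mono (ENNReal.add_ne_top.2
      ⟨networkDist_ne_top _ _, networkDist_ne_top _ _⟩) (networkDist_triangle _ _ _)
  eq_of_dist_eq_zero := by
    rintro ⟨L⟩ ⟨L'⟩ h
    have h' : (networkDist L L').toReal = 0 := h
    rw [ENNReal.toReal_eq_zero_iff] at h'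
    exact Quot.sound (networkDist_eq_zero_iff.1 (h'.resolve_right (networkDist_ne_top _ _)))

theorem edist_toClass (L L' : LabelledNetwork.{u} Λ) :
    edist L.toClass L'.toClass = networkDist L L' := by
  rw [edist_dist]
  exact ENNReal.ofReal_toReal (networkDist_ne_top L L')

omit [∀ i, InnerProductSpace ℝ (Λ i)] [∀ i, BorelSpace (Λ i)] in
theorem exists_rep (x : LabelledNetworkClass.{u} Λ) : ∃ L : LabelledNetwork.{u} Λ, L.toClass = x :=
  Quot.exists_rep x

theorem dist_eq_of_networkDist_eq {L L' : LabelledNetwork.{u} Λ} {H : Type*} [PseudoMetricSpace H]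
    {a b : H} (h : networkDist L L' = 1 / 2 * edist a b) :
    dist L.toClass L'.toClass = 1 / 2 * dist a b := by
  rw [dist_edist, dist_edist, edist_toClass, h, ENNReal.toReal_mul]
  norm_num

section Pullback

variable {Ω : Fin k → Type*} [∀ i, MeasurableSpace (Ω i)] {P : ∀ i, Measure (Ω i)}
  [∀ i, IsProbabilityMeasure (P i)]

theorem dist_toClass_le (L L' : LabelledNetwork.{u} Λ) {φ : ∀ i, Ω i → L.X i}
    (hφ : ∀ i, MeasurePreserving (φ i) (P i) (L.μ i)) {φ' : ∀ i, Ω i → L'.X i}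
    (hφ' : ∀ i, MeasurePreserving (φ' i) (P i) (L'.μ i)) :
    dist L.toClass L'.toClass ≤ 1 / 2 * dist (L.pullback φ hφ) (L'.pullback φ' hφ') := by
  have h := networkDist_le_edist_pullback L L' hφ hφ'
  rw [← edist_toClass] at h
  have := ENNReal.toReal_mono (ENNReal.mul_ne_top (by norm_num) (edist_ne_top _ _)) h
  rw [ENNReal.toReal_mul, ← dist_edist, ← dist_edist] at this
  simpa using this

end Pullback

section OfNetSpace

variable {Ω : Fin k → Type u} [∀ i, TopologicalSpace (Ω i)] [∀ i, PolishSpace (Ω i)]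
  [∀ i, MeasurableSpace (Ω i)] [∀ i, BorelSpace (Ω i)] {P : ∀ i, Measure (Ω i)}
  [∀ i, IsProbabilityMeasure (P i)]

theorem dist_toNetwork_le {v : NetSpace Λ P} (hv : v.KernelNonneg) (L : LabelledNetwork.{u} Λ)
    {φ : ∀ i, Ω i → L.X i} (hφ : ∀ i, MeasurePreserving (φ i) (P i) (L.μ i)) :
    dist L.toClass v.toNetwork.toClass ≤ 1 / 2 * dist (L.pullback φ hφ) v := by
  have := dist_toClass_le L v.toNetwork hφ fun i => MeasurePreserving.id (P i)
  rwa [NetSpace.pullback_toNetwork hv] at this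

theorem dist_toNetwork_toNetwork_le {v w : NetSpace Λ P} (hv : v.KernelNonneg)
    (hw : w.KernelNonneg) :
    dist v.toNetwork.toClass w.toNetwork.toClass ≤ 1 / 2 * dist v w := by
  have := dist_toNetwork_le hw v.toNetwork fun i => MeasurePreserving.id (P i)
  rwa [NetSpace.pullback_toNetwork hv] at this

theorem toClass_toNetwork_pullback (L : LabelledNetwork.{u} Λ) {φ : ∀ i, Ω i → L.X i}
    (hφ : ∀ i, MeasurePreserving (φ i) (P i) (L.μ i)) :
    (L.pullback φ hφ).toNetwork.toClass = L.toClass := by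
  refine (dist_le_zero.1 ?_).symm
  have := dist_toNetwork_le (L.kernelNonneg_pullback hφ) L hφ
  rwa [dist_self, mul_zero] at this

end OfNetSpace

/-- The segment between optimally coupled pullbacks projects to a geodesic: projection does not
increase distances beyond the factor `1 / 2`, and the endpoints leave no slack in the triangle
inequality. -/
theorem isGeodesicSpace : IsGeodesicSpace (LabelledNetworkClass.{u} Λ) := by
  intro x y
  obtain ⟨L, rfl⟩ := exists_rep x
  obtain ⟨L', rfl⟩ := exists_rep y
  obtain ⟨R, _, h1, h2, h⟩ := exists_realization L L'
  have hD := dist_eq_of_networkDist_eq h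
  set a := L.pullback (fun _ => Prod.fst) h1 with ha
  set b := L'.pullback (fun _ => Prod.snd) h2 with hb
  have hpos : ∀ t : unitInterval, (AffineMap.lineMap a b (t : ℝ) : NetSpace Λ R).KernelNonneg :=
    fun t => (L.kernelNonneg_pullback h1).lineMap (L'.kernelNonneg_pullback h2) t
  let γ : unitInterval → LabelledNetworkClass.{u} Λ := fun t =>
    (AffineMap.lineMap a b (t : ℝ) : NetSpace Λ R).toNetwork.toClass
  have h0 : γ 0 = L.toClass := by
    simp only [γ, Set.Icc.coe_zero, AffineMap.lineMap_apply_zero]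
    exact toClass_toNetwork_pullback L h1
  have h1' : γ 1 = L'.toClass := by
    simp only [γ, Set.Icc.coe_one, AffineMap.lineMap_apply_one]
    exact toClass_toNetwork_pullback L' h2
  have hle : ∀ s t : unitInterval, s ≤ t →
      dist (γ s) (γ t) ≤ ((t : ℝ) - s) * dist L.toClass L'.toClass := by
    intro s t hst
    refine (dist_toNetwork_toNetwork_le (hpos s) (hpos t)).trans ?_
    rw [dist_lineMap_lineMap, hD, Real.dist_eq, abs_sub_comm,
      abs_of_nonneg (sub_nonneg.2 (Subtype.coe_le_coe.2 hst))]
    linarith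
  refine ⟨γ, fun s t hst => ?_, h0, h1'⟩
  have e1 := hle 0 s unitInterval.nonneg'
  have e2 := hle t 1 unitInterval.le_one'
  have e3 := dist_triangle4 (γ 0) (γ s) (γ t) (γ 1)
  rw [Set.Icc.coe_zero] at e1
  rw [Set.Icc.coe_one] at e2
  refine le_antisymm ?_ ?_
  · rw [h0, h1']
    exact hle s t hst
  · rw [h0, h1'] at e3 ⊢
    rw [h0] at e1
    rw [h1'] at e2
    linarith

theorem curvatureBoundedBelowByZero :
    CurvatureBoundedBelowByZero (LabelledNetworkClass.{u} Λ) := by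
  intro γ hγ x t
  have hγ0 := hγ 0 t unitInterval.nonneg'
  have hγ1 := hγ t 1 unitInterval.le_one'
  rw [Set.Icc.coe_zero, sub_zero] at hγ0
  rw [Set.Icc.coe_one] at hγ1
  obtain ⟨A, hA⟩ := exists_rep (γ 0)
  obtain ⟨B, hB⟩ := exists_rep (γ t)
  obtain ⟨C, hC⟩ := exists_rep (γ 1)
  obtain ⟨E, rfl⟩ := exists_rep x
  -- All gluings are centred at `B`, so its distances to `A`, `C` and `E` are realized exactly on
  -- one space; the other distances are only bounded above.
  obtain ⟨R, _, r1, r2, hr⟩ := exists_realization B A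
  obtain ⟨S, _, s1, s2, hs⟩ := exists_extension B C r1
  obtain ⟨T, _, t1, t2, hT⟩ := exists_extension B E fun i => (r1 i).comp (s1 i)
  let a : NetSpace Λ T := A.pullback _ fun i => ((r2 i).comp (s1 i)).comp (t1 i)
  let b : NetSpace Λ T := B.pullback _ fun i => ((r1 i).comp (s1 i)).comp (t1 i)
  let c : NetSpace Λ T := C.pullback _ fun i => (s2 i).comp (t1 i)
  let e : NetSpace Λ T := E.pullback _ t2
  rw [← edist_pullback_comp B A r1 r2 s1, ← edist_pullback_comp B A _ _ t1] at hr
  rw [← edist_pullback_comp B C _ s2 t1] at hs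
  have dBA : dist (γ t) (γ 0) = 1 / 2 * ‖a - b‖ := by
    rw [← hA, ← hB, ← dist_eq_norm, dist_comm a b]
    exact dist_eq_of_networkDist_eq hr
  have dBC : dist (γ t) (γ 1) = 1 / 2 * ‖c - b‖ := by
    rw [← hB, ← hC, ← dist_eq_norm, dist_comm c b]
    exact dist_eq_of_networkDist_eq hs
  have dBE : dist (γ t) E.toClass = 1 / 2 * ‖b - e‖ := by
    rw [← hB, ← dist_eq_norm]
    exact dist_eq_of_networkDist_eq hT
  have uAC : dist (γ 0) (γ 1) ≤ 1 / 2 * ‖a - c‖ := by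
    rw [← hA, ← hC, ← dist_eq_norm]
    exact dist_toClass_le A C _ _
  have uAE : dist (γ 0) E.toClass ≤ 1 / 2 * ‖a - e‖ := by
    rw [← hA, ← dist_eq_norm]
    exact dist_toClass_le A E _ _
  have uCE : dist (γ 1) E.toClass ≤ 1 / 2 * ‖c - e‖ := by
    rw [← hC, ← dist_eq_norm]
    exact dist_toClass_le C E _ _
  -- The factor 2 in `D` undoes the `1 / 2` in the network distance.
  have key := norm_sub_sq_comparison (a := a) (b := b) (c := c) (e := e) (t := t)
    (D := 2 * dist (γ 0) (γ 1)) t.2.1 t.2.2 (by rw [dist_comm] at hγ0; linarith) (by linarith)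
    (by linarith) (by positivity)
  have qAE := mul_le_mul_of_nonneg_left (pow_le_pow_left₀ dist_nonneg uAE 2)
    (sub_nonneg.2 t.2.2)
  have qCE := mul_le_mul_of_nonneg_left (pow_le_pow_left₀ dist_nonneg uCE 2) t.2.1
  rw [dBE]
  linarith

/-- Consecutive optimal couplings are glued on a countable product, which is still Polish. The
pullbacks form a Cauchy sequence there, and the closed cone of non-negative kernels contains the
limit. -/
theorem completeSpace [∀ i, CompleteSpace (Λ i)] : CompleteSpace (LabelledNetworkClass.{u} Λ) := by
  refine Metric.complete_of_convergent_controlled_sequences (fun n => (1 / 2 : ℝ) ^ n)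
    (fun n => by positivity) fun u hu => ?_
  choose L hL using fun n => exists_rep (u n)
  choose π hπ hopt using fun n => exists_optimal_coupling (L n) (L (n + 1))
  choose R hR hmp hpair using fun i => exists_sequence_gluing (X := fun n => (L n).X i)
    (μ := fun n => (L n).μ i) (π := fun n => π n i) fun n => hπ n i
  let v : ℕ → NetSpace Λ R := fun n => (L n).pullback (fun i x => x n) fun i => hmp i n
  have hdist : ∀ n, dist (v n) (v (n + 1)) ≤ 2 * (1 / 2 : ℝ) ^ n := by
    intro n
    have h : networkDist (L n) (L (n + 1)) = 1 / 2 * edist (v n) (v (n + 1)) := by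
      rw [hopt, edist_pullback]
      congr 3
      funext i
      exact (hpair i n).symm
    have h2 := dist_eq_of_networkDist_eq h
    have h3 := hu n n (n + 1) le_rfl (Nat.le_succ n)
    rw [hL, hL] at h2
    linarith
  obtain ⟨w, hw⟩ := cauchySeq_tendsto_of_complete
    (cauchySeq_of_le_geometric (1 / 2 : ℝ) 2 (by norm_num) hdist)
  have hwpos : w.KernelNonneg := NetSpace.isClosed_kernelNonneg.mem_of_tendsto hw
    (Eventually.of_forall fun n => (L n).kernelNonneg_pullback _)
  refine ⟨w.toNetwork.toClass, ?_⟩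
  rw [tendsto_iff_dist_tendsto_zero] at hw ⊢
  refine squeeze_zero (fun n => dist_nonneg) (fun n => ?_) (by simpa using hw.const_mul (1 / 2))
  rw [← hL n]
  exact dist_toNetwork_le hwpos (L n) fun i => hmp i n

theorem isAlexandrovNonneg [∀ i, CompleteSpace (Λ i)] :
    IsAlexandrovNonneg (LabelledNetworkClass.{u} Λ) :=
  ⟨completeSpace, isGeodesicSpace, curvatureBoundedBelowByZero⟩

end LabelledNetworkClass

end NetworkDistance

theorem theorem3 {𝕜 : Type*} [RCLike 𝕜] (k : ℕ) (hk : 1 ≤ k) (Λ : Fin k → Type v)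
    [∀ i, NormedAddCommGroup (Λ i)] [∀ i, InnerProductSpace 𝕜 (Λ i)] [∀ i, CompleteSpace (Λ i)]
    [∀ i, MeasurableSpace (Λ i)] [∀ i, BorelSpace (Λ i)] :
    Equivalence (LabelledNetwork.WeaklyIsomorphic.{u} (Λ := Λ)) ∧
    ∃ _ : MetricSpace (LabelledNetworkClass.{u} Λ),
      (∀ L L' : LabelledNetwork.{u} Λ,
        edist L.toClass L'.toClass = LabelledNetwork.networkDist L L') ∧
      IsAlexandrovNonneg (LabelledNetworkClass.{u} Λ) := by
  -- Restricting scalars keeps the norm, so the real case covers complex label spaces.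
  let _ : ∀ i, InnerProductSpace ℝ (Λ i) := fun i => InnerProductSpace.rclikeToReal 𝕜 (Λ i)
  exact ⟨LabelledNetwork.equivalence_weaklyIsomorphic, LabelledNetworkClass.instMetricSpace,
    LabelledNetworkClass.edist_toClass, LabelledNetworkClass.isAlexandrovNonneg⟩
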